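/- Let $\tau\ge 0$ and $p_1,\dots,p_\tau\ge 1$ be integers, let $\Delta^{n}=\{u\in\mathbb{R}^{n}_{\ge 0} : \sum_j u_j=1\}$, and let $D=\Delta^{p_1}\times\cdots\times\Delta^{p_\tau}$, whose points are written $x=(x_{i,j})_{1\le i\le \tau,\,1\le j\le p_i}$. Let $f(x)=w\cdot x+b=\sum_{i=1}^{\tau}\sum_{j=1}^{p_i}w_{i,j}x_{i,j}+b$ be an affine function with $w_{i,1}\le\cdots\le w_{i,p_i}$ for each $i$, let $\mathrm{ReLU}(v)=\max\{0,v\}$, and let $\operatorname{gr}(\mathrm{ReLU}\circ f;D)=\{(x,y) : x\in D,\ y=\mathrm{ReLU}(f(x))\}$. Consider the system \begin{align} & y\ \ge\ w\cdot x+b, \tag{1}\\ & y\ \le\ \sum_{i=1}^{\tau}\Bigl(w_{i,J(i)}\,z+\sum_{j=J(i)+1}^{p_i}(w_{i,j}-w_{i,J(i)})\,x_{i,j}\Bigr)+b\,z \quad\text{for all mappings } J \text{ with } J(i)\in\{1,\dots,p_i\}\ (1\le i\le\tau), \tag{2}\\ & (x,y,z)\in D\times\mathbb{R}_{\ge 0}\times\{0,1\},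 \tag{3} \end{align} and let $Q$ be its linear programming relaxation, in which $z\in\{0,1\}$ is replaced by $z\in[0,1]$. Then: (a) The system (1)--(3) is an ideal formulation of $\operatorname{gr}(\mathrm{ReLU}\circ f;D)$. That is, $Q$ is a polyhedron, the projection of $\{(x,y,z)\in Q : z\in\{0,1\}\}$ onto the $(x,y)$-space equals $\operatorname{gr}(\mathrm{ReLU}\circ f;D)$, and $z\in\{0,1\}$ at every extreme point of $Q$. (b) There is one program for a real random access machine with unit costs (registers and arrays of natural numbers and of real numbers; addition, subtraction, comparison, multiplication of reals, and indexed access to arrays each count one step) which, given $\tau$, the $p_i$, weights $w$ sorted as above, $b$, and any point $(x,y,z)$ with real entries, decides whether the point violates some constraint of the family (2) and, if so, outputs a mapping $J$ whose constraint is most violated at the point (the right-hand side of (2) is smallest). It does so in $\mathcal{O}(p_1+\cdots+p_\tau)$ steps (for $\tau=0$, in $\mathcal{O}(1)$ steps), with a constant that does not depend on the input. (c) No constraint of the family (2) is redundant: for each mapping $J$, removing the halfspace of $(x,y,z)$ defined by the constraint for $J$ (which may also be the halfspace of other mappings, and all these copies are removed) strictly enlarges the set of points of $D\times\mathbb{R}\times[0,1]$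 that satisfy (2). If moreover the neuron is irreducible, meaning that $f(x)>0$ for some $x\in D$ and $f(x)<0$ for some $x\in D$, then this removal also strictly enlarges $Q$. -/

import Mathlib

namespace OneHotReLU

/-! ### Mixed-integer formulations with one binary variable and no auxiliary continuous variable -/

/-- A polyhedron: the solution set of finitely many linear inequalities. -/
def IsPolyhedron {E : Type*} [AddCommGroup E] [Module ℝ E] (Q : Set E) : Prop :=
  ∃ (m : ℕ) (a : Fin m → (E →ₗ[ℝ] ℝ)) (c : Fin m → ℝ), Q = {v | ∀ k, a k v ≤ c k}

/-- The polyhedron `Q` in the variables `(x, y, z)`, together with the requirement `z ∈ {0, 1}`, is a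
valid mixed-integer formulation of `S`: the projection onto `(x, y)` of the points of `Q` with
binary `z` is exactly `S`. The set `Q` is the linear programming relaxation. -/
structure IsMIPFormulation {X : Type*} [AddCommGroup X] [Module ℝ X]
    (Q : Set (X × ℝ × ℝ)) (S : Set (X × ℝ)) : Prop where
  isPolyhedron : IsPolyhedron Q
  valid : S = {s | ∃ z : ℝ, (z = 0 ∨ z = 1) ∧ (s.1, s.2, z) ∈ Q}

/-- A formulation is ideal if every extreme point of its linear programming relaxation has a
binary `z`. -/
structure IsIdealFormulation {X : Type*} [AddCommGroup X] [Module ℝ X]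
    (Q : Set (X × ℝ × ℝ)) (S : Set (X × ℝ)) : Prop extends IsMIPFormulation Q S where
  ideal : ∀ v ∈ Set.extremePoints ℝ Q, v.2.2 = 0 ∨ v.2.2 = 1

/-! ### The ReLU of an affine function on a product of simplices -/

/-- Points `x = (x i j)`, where `i` is the index of the simplex and `j` the coordinate in it. -/
abbrev Point {τ : ℕ} (p : Fin τ → ℕ) : Type := (i : Fin τ) → Fin (p i) → ℝ

/-- The product of the simplices `Δ^(p i)`. -/
def simplexProduct {τ : ℕ} (p : Fin τ → ℕ) : Set (Point p) :=
  {x | ∀ i, x i ∈ stdSimplex ℝ (Fin (p i))}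

/-- The rectified linear unit. -/
def relu (v : ℝ) : ℝ := max 0 v

/-- The affine function `f(x) = w · x + b`. -/
def affine {τ : ℕ} {p : Fin τ → ℕ} (w : Point p) (b : ℝ) (x : Point p) : ℝ :=
  (∑ i, ∑ j, w i j * x i j) + b

/-- The right-hand side of the upper bound on `y` that belongs to the mapping `J`. -/
def upperBound {τ : ℕ} {p : Fin τ → ℕ} (w : Point p) (b : ℝ) (J : (i : Fin τ) → Fin (p i))
    (x : Point p) (z : ℝ) : ℝ :=
  (∑ i, (w i (J i) * z + ∑ j ∈ Finset.Ioi (J i), (w i j - w i (J i)) * x i j)) + b * z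

/-- The halfspace of all `(x, y, z)` that satisfy the upper bound belonging to `J`. -/
def halfspace {τ : ℕ} {p : Fin τ → ℕ} (w : Point p) (b : ℝ) (J : (i : Fin τ) → Fin (p i)) :
    Set (Point p × ℝ × ℝ) :=
  {v | v.2.1 ≤ upperBound w b J v.1 v.2.2}

/-- The points of `D × ℝ × [0, 1]` that satisfy the upper bounds with index in `F`. -/
def upperRegion {τ : ℕ} {p : Fin τ → ℕ} (w : Point p) (b : ℝ)
    (F : Set ((i : Fin τ) → Fin (p i))) : Set (Point p × ℝ × ℝ) :=
  {v | v.1 ∈ simplexProduct p ∧ v.2.2 ∈ Set.Icc (0 : ℝ) 1 ∧ ∀ J ∈ F, v ∈ halfspace w b J}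

/-- The linear programming relaxation of the system in which, of the family of upper bounds, only
those with index in `F` are kept: `y ≥ w · x + b`, the upper bounds, and
`(x, y, z) ∈ D × ℝ≥0 × [0, 1]`. The whole system has `F = Set.univ`. -/
def relaxation {τ : ℕ} {p : Fin τ → ℕ} (w : Point p) (b : ℝ)
    (F : Set ((i : Fin τ) → Fin (p i))) : Set (Point p × ℝ × ℝ) :=
  {v | affine w b v.1 ≤ v.2.1 ∧ (∀ J ∈ F, v ∈ halfspace w b J) ∧
    v.1 ∈ simplexProduct p ∧ 0 ≤ v.2.1 ∧ v.2.2 ∈ Set.Icc (0 : ℝ) 1}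

/-- The mappings whose inequality does not describe the same halfspace as that of `J`. -/
def otherHalfspaces {τ : ℕ} {p : Fin τ → ℕ} (w : Point p) (b : ℝ) (J : (i : Fin τ) → Fin (p i)) :
    Set ((i : Fin τ) → Fin (p i)) :=
  {J' | halfspace w b J' ≠ halfspace w b J}

/-- The neuron is irreducible: each of the two affine functions `w · x + b` and `0` is the strict
maximum of the two somewhere on the domain. -/
def IsIrreducible {τ : ℕ} {p : Fin τ → ℕ} (w : Point p) (b : ℝ) : Prop :=
  (∃ x ∈ simplexProduct p, 0 < affine w b x) ∧ (∃ x ∈ simplexProduct p, affine w b x < 0)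

/-- The upper bound belonging to `J` is violated at `(x, y, z)`, and no other member of the family
is violated by a larger amount. -/
def IsMostViolated {τ : ℕ} {p : Fin τ → ℕ} (w : Point p) (b : ℝ) (x : Point p) (y z : ℝ)
    (J : (i : Fin τ) → Fin (p i)) : Prop :=
  upperBound w b J x z < y ∧ ∀ J', y - upperBound w b J' x z ≤ y - upperBound w b J x z

/-! ### A real random access machine with unit costs

The machine has registers and arrays that hold natural numbers, and registers and arrays that hold
real numbers. The arrays are addressed by the contents of natural number registers. Each
instruction and each evaluation of a test costs one step. -/

/-- The memory contents. -/
structure Store where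
  /-- registers for natural numbers -/
  nreg : ℕ → ℕ
  /-- registers for real numbers -/
  rreg : ℕ → ℝ
  /-- arrays of natural numbers (number of the array, position in it) -/
  narr : ℕ → ℕ → ℕ
  /-- arrays of real numbers (number of the array, position in it) -/
  rarr : ℕ → ℕ → ℝ

/-- The tests: comparison of two registers of the same kind. -/
inductive Test where
  | nlt (a b : ℕ)
  | rlt (a b : ℕ)

/-- Whether a test succeeds. -/
def Test.Holds : Test → Store → Prop
  | .nlt a b, s => s.nreg a < s.nreg b
  | .rlt a b, s => s.rreg a < s.rreg b

/-- The elementary instructions; `d` is always the destination register. -/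
inductive Instr where
  | nconst (d c : ℕ)
  | nadd (d a b : ℕ)
  | nsub (d a b : ℕ)
  | nload (d arr idx : ℕ)
  | nstore (arr idx a : ℕ)
  | rconst (d : ℕ) (c : ℤ)
  | radd (d a b : ℕ)
  | rsub (d a b : ℕ)
  | rmul (d a b : ℕ)
  | rload (d arr idx : ℕ)
  | rstore (arr idx a : ℕ)

/-- The effect of an instruction. Subtraction of natural numbers is truncated at `0`. -/
def Instr.run : Instr → Store → Store
  | .nconst d c, s => { s with nreg := Function.update s.nreg d c }
  | .nadd d a b, s => { s with nreg := Function.update s.nreg d (s.nreg a + s.nreg b) }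
  | .nsub d a b, s => { s with nreg := Function.update s.nreg d (s.nreg a - s.nreg b) }
  | .nload d arr idx, s =>
      { s with nreg := Function.update s.nreg d (s.narr arr (s.nreg idx)) }
  | .nstore arr idx a, s =>
      { s with
        narr := Function.update s.narr arr (Function.update (s.narr arr) (s.nreg idx) (s.nreg a)) }
  | .rconst d c, s => { s with rreg := Function.update s.rreg d (c : ℝ) }
  | .radd d a b, s => { s with rreg := Function.update s.rreg d (s.rreg a + s.rreg b) }
  | .rsub d a b, s => { s with rreg := Function.update s.rreg d (s.rreg a - s.rreg b) }
  | .rmul d a b, s => { s with rreg := Function.update s.rreg d (s.rreg a * s.rreg b) }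
  | .rload d arr idx, s =>
      { s with rreg := Function.update s.rreg d (s.rarr arr (s.nreg idx)) }
  | .rstore arr idx a, s =>
      { s with
        rarr := Function.update s.rarr arr (Function.update (s.rarr arr) (s.nreg idx) (s.rreg a)) }

/-- Programs. -/
inductive Prog where
  | instr (c : Instr)
  | seq (P Q : Prog)
  | cond (t : Test) (P Q : Prog)
  | loop (t : Test) (P : Prog)

/-- `Exec P s n s'`: started in the store `s`, the program `P` halts after exactly `n` steps in the
store `s'`. -/
inductive Exec : Prog → Store → ℕ → Store → Prop where
  | instr (c : Instr) (s : Store) : Exec (.instr c) s 1 (c.run s)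
  | seq {P Q : Prog} {s s' s'' : Store} {m n : ℕ} (hP : Exec P s m s') (hQ : Exec Q s' n s'') :
      Exec (.seq P Q) s (m + n) s''
  | cond_true {t : Test} {P Q : Prog} {s s' : Store} {n : ℕ} (ht : t.Holds s)
      (hP : Exec P s n s') : Exec (.cond t P Q) s (n + 1) s'
  | cond_false {t : Test} {P Q : Prog} {s s' : Store} {n : ℕ} (ht : ¬ t.Holds s)
      (hQ : Exec Q s n s') : Exec (.cond t P Q) s (n + 1) s'
  | loop_true {t : Test} {P : Prog} {s s' s'' : Store} {m n : ℕ} (ht : t.Holds s)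
      (hP : Exec P s m s') (hloop : Exec (.loop t P) s' n s'') :
      Exec (.loop t P) s (m + n + 1) s''
  | loop_false {t : Test} {P : Prog} {s : Store} (ht : ¬ t.Holds s) :
      Exec (.loop t P) s 1 s

/-- The entries of `v`, listed simplex by simplex, followed by zeros. -/
noncomputable def flatten {τ : ℕ} {p : Fin τ → ℕ} (v : Point p) (k : ℕ) : ℝ :=
  if h : k < ∑ i, p i then
    v (finSigmaFinEquiv.symm ⟨k, h⟩).1 (finSigmaFinEquiv.symm ⟨k, h⟩).2
  else 0

/-- The store that holds the input of the separation problem, and zeros elsewhere: `τ` in a natural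
number register, `b`, `y`, `z` in real registers, the sizes `p i` in an array of natural
numbers, and the weights and the point in two arrays of reals. -/
noncomputable def inputStore {τ : ℕ} (p : Fin τ → ℕ) (w : Point p) (b : ℝ) (x : Point p)
    (y z : ℝ) : Store where
  nreg a := if a = 0 then τ else 0
  rreg a := if a = 0 then b else if a = 1 then y else if a = 2 then z else 0
  narr a i := if a = 0 then (if h : i < τ then p ⟨i, h⟩ else 0) else 0
  rarr a k := if a = 0 then flatten w k else if a = 1 then flatten x k else 0

/-- The final store `s` answers the separation problem at `(x, y, z)`: register `1` tells whether
some upper bound of the family is violated, and if so then array `1` contains a mapping whose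
upper bound is most violated (with the coordinates in each simplex counted from `0`). -/
def Answers {τ : ℕ} {p : Fin τ → ℕ} (w : Point p) (b : ℝ) (x : Point p) (y z : ℝ)
    (s : Store) : Prop :=
  (s.nreg 1 = 0 ∧ ∀ J : (i : Fin τ) → Fin (p i), y ≤ upperBound w b J x z) ∨
  (s.nreg 1 = 1 ∧ ∃ J : (i : Fin τ) → Fin (p i),
    (∀ i : Fin τ, s.narr 1 i = J i) ∧ IsMostViolated w b x y z J)

end OneHotReLU

namespace OneHotReLU

/-! The right-hand side of (2) is `b * z` plus one `term` per simplex, so the choices J(i) do not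
interact. Because the weights are sorted, the term of k equals w_k z + ∑_j max(w_j - w_k, 0) x_j.
This is the dual bound, with multiplier w_k, for the continuous knapsack that maximises ∑ w_j u_j
over 0 ≤ u ≤ x, ∑ u_j = z. Filling greedily from the largest weight attains one of these bounds
(`exists_fill`), so the family (2) says that y is at most the total knapsack value plus bz.

Ideality: for 0 < z < 1, the filling u = z x has value z f(x) ≤ y, while the greedy one has value at
least y. An interpolation v has value exactly y, and x₁ = v / z, x₀ = (x - v) / (1 - z) give x = z
x₁ + (1 - z) x₀ and y = z f(x₁) (`exists_split`). The lower bounds on y then force f(x₁) ≥ 0 ≥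
f(x₀), so (x, y, z) lies strictly between (x₁, f(x₁), 1) and (x₀, 0, 0), both in Q, and is not
extreme.

Irredundancy: let x₁ live on positions ≥ J and x₀ on positions ≤ J, both with mass at J itself. At
the midpoint of (x₁, 1) and (x₀, 0) the bound of J equals f(x₁) / 2, and every bound with another
halfspace is strictly larger (`exists_separated`), which leaves room to raise y.

Separation: minimise each simplex separately. One backward scan with running sums of x_j and w_j x_j
evaluates each term in constant time. -/

/-! ### The contribution of one simplex to an upper bound -/

/-- The summand of `upperBound` that belongs to one simplex. -/
def term {n : ℕ} (w : Fin n → ℝ) (k : Fin n) (x : Fin n → ℝ) (z : ℝ) : ℝ :=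
  w k * z + ∑ j ∈ Finset.Ioi k, (w j - w k) * x j

theorem upperBound_eq_sum_term {τ : ℕ} {p : Fin τ → ℕ} (w : Point p) (b : ℝ)
    (J : (i : Fin τ) → Fin (p i)) (x : Point p) (z : ℝ) :
    upperBound w b J x z = (∑ i, term (w i) (J i) (x i) z) + b * z := rfl

/-- Sortedness makes the positive part vanish for j ≤ k, so the sum over j > k extends to all j. -/
theorem term_eq_sum_max {n : ℕ} {w : Fin n → ℝ} (hw : Monotone w) (k : Fin n) (x : Fin n → ℝ)
    (z : ℝ) : term w k x z = w k * z + ∑ j, max (w j - w k) 0 * x j := by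
  unfold term
  congr 1
  refine Finset.sum_subset_zero_on_sdiff (Finset.subset_univ _) ?_ ?_
  · intro j hj
    have hjk : j ≤ k := by simpa using hj
    rw [max_eq_right (sub_nonpos.2 (hw hjk)), zero_mul]
  · intro j hj
    have hkj : k < j := by simpa using hj
    rw [max_eq_left (sub_nonneg.2 (hw hkj.le))]

/-- Since x has mass 1, w_k can be spread over the coordinates, and max(w_j - w_k, 0) + w_k = w_j +
max(w_k - w_j, 0). The last sum is the excess of the bound over w · x. -/
theorem term_one_eq {n : ℕ} {w : Fin n → ℝ} (hw : Monotone w) (k : Fin n) {x : Fin n → ℝ}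
    (hx : x ∈ stdSimplex ℝ (Fin n)) :
    term w k x 1 = ∑ j, w j * x j + ∑ j, max (w k - w j) 0 * x j := by
  have h1 : w k * 1 = ∑ j, w k * x j := by rw [← Finset.mul_sum, hx.2]
  rw [term_eq_sum_max hw, h1, ← Finset.sum_add_distrib, ← Finset.sum_add_distrib]
  refine Finset.sum_congr rfl fun j _ => ?_
  rcases le_total (w j) (w k) with h | h
  · rw [max_eq_right (by linarith), max_eq_left (by linarith)]; ring
  · rw [max_eq_left (by linarith), max_eq_right (by linarith)]; ring

theorem term_zero_eq {n : ℕ} {w : Fin n → ℝ} (hw : Monotone w) (k : Fin n) (x : Fin n → ℝ) :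
    term w k x 0 = ∑ j, max (w j - w k) 0 * x j := by
  rw [term_eq_sum_max hw, mul_zero, zero_add]

theorem term_zero_nonneg {n : ℕ} {w : Fin n → ℝ} (hw : Monotone w) (k : Fin n) {x : Fin n → ℝ}
    (hx : x ∈ stdSimplex ℝ (Fin n)) : 0 ≤ term w k x 0 := by
  rw [term_zero_eq hw]
  exact Finset.sum_nonneg fun j _ => mul_nonneg (le_max_right _ _) (hx.1 j)

theorem sum_le_term_one {n : ℕ} {w : Fin n → ℝ} (hw : Monotone w) (k : Fin n) {x : Fin n → ℝ}
    (hx : x ∈ stdSimplex ℝ (Fin n)) : ∑ j, w j * x j ≤ term w k x 1 := by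
  rw [term_one_eq hw k hx]
  exact le_add_of_nonneg_right
    (Finset.sum_nonneg fun j _ => mul_nonneg (le_max_right _ _) (hx.1 j))

theorem term_one_of_support {n : ℕ} {w : Fin n → ℝ} (hw : Monotone w) {k : Fin n} {x : Fin n → ℝ}
    (hx : x ∈ stdSimplex ℝ (Fin n)) (hs : ∀ j < k, x j = 0) :
    term w k x 1 = ∑ j, w j * x j := by
  rw [term_one_eq hw k hx, add_eq_left]
  refine Finset.sum_eq_zero fun j _ => ?_
  rcases lt_or_ge j k with h | h
  · rw [hs j h, mul_zero]
  · rw [max_eq_right (sub_nonpos.2 (hw h)), zero_mul]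

theorem term_zero_of_support {n : ℕ} {w : Fin n → ℝ} {k : Fin n} {x : Fin n → ℝ}
    (hs : ∀ j, k < j → x j = 0) : term w k x 0 = 0 := by
  unfold term
  rw [mul_zero, zero_add]
  exact Finset.sum_eq_zero fun j hj => by rw [hs j (Finset.mem_Ioi.1 hj), mul_zero]

/-- The term is jointly linear in (x, z), evaluated here at s (x₁, 1) + (1 - s) (x₀, 0). -/
theorem term_convexComb {n : ℕ} (w : Fin n → ℝ) (k : Fin n) (x₁ x₀ : Fin n → ℝ) (s : ℝ) :
    term w k (s • x₁ + (1 - s) • x₀) s = s * term w k x₁ 1 + (1 - s) * term w k x₀ 0 := by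
  unfold term
  have : ∑ j ∈ Finset.Ioi k, (w j - w k) * (s • x₁ + (1 - s) • x₀) j
      = s * ∑ j ∈ Finset.Ioi k, (w j - w k) * x₁ j
        + (1 - s) * ∑ j ∈ Finset.Ioi k, (w j - w k) * x₀ j := by
    rw [Finset.mul_sum, Finset.mul_sum, ← Finset.sum_add_distrib]
    refine Finset.sum_congr rfl fun j _ => ?_
    simp only [Pi.add_apply, Pi.smul_apply, smul_eq_mul]
    ring
  rw [this]
  ring

/-- Filling a knapsack of size `z` from the top of the index range attains one of the terms. -/
theorem exists_fill {n : ℕ} (hn : 0 < n) (w : Fin n → ℝ) {x : Fin n → ℝ}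
    (hx : x ∈ stdSimplex ℝ (Fin n)) {z : ℝ} (hz : z ∈ Set.Icc (0 : ℝ) 1) :
    ∃ (k : Fin n) (u : Fin n → ℝ), (∀ j, 0 ≤ u j) ∧ (∀ j, u j ≤ x j) ∧ ∑ j, u j = z ∧
      ∑ j, w j * u j = term w k x z := by
  classical
  obtain ⟨hx0, hx1⟩ := hx
  -- Positions whose strict upper tail fits into the knapsack. The least one is the split item:
  -- everything above it is packed whole, and it fills the remaining space.
  let A : Finset (Fin n) := Finset.univ.filter fun k => ∑ j ∈ Finset.Ioi k, x j ≤ z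
  have hA : A.Nonempty := by
    refine ⟨⟨n - 1, by omega⟩, ?_⟩
    have : Finset.Ioi (⟨n - 1, by omega⟩ : Fin n) = ∅ := by
      ext j
      simp [Fin.lt_def]
      omega
    simp [A, this, hz.1]
  obtain ⟨k, hkA, hmin⟩ := A.exists_min_image id hA
  have hk : ∑ j ∈ Finset.Ioi k, x j ≤ z := by simpa [A] using hkA
  have hk' : z ≤ x k + ∑ j ∈ Finset.Ioi k, x j := by
    have hins : x k + ∑ j ∈ Finset.Ioi k, x j = ∑ j ∈ Finset.Ici k, x j := by
      rw [← Finset.Ioi_insert, Finset.sum_insert (by simp)]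
    rw [hins]
    -- If k is the first position, its closed tail has mass 1 ≥ z. Otherwise that tail is the strict
    -- tail of k - 1, which cannot fit by minimality.
    by_cases h0 : (k : ℕ) = 0
    · have : Finset.Ici k = Finset.univ := by
        ext j
        simp [Fin.le_def, h0]
      rw [this, hx1]
      exact hz.2
    · by_contra! hlt
      have hmem : (⟨k - 1, by omega⟩ : Fin n) ∈ A := by
        have : Finset.Ioi (⟨k - 1, by omega⟩ : Fin n) = Finset.Ici k := by
          ext j
          simp only [Finset.mem_Ioi, Finset.mem_Ici, Fin.lt_def, Fin.le_def]
          omega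
        simp [A, this, hlt.le]
      have := hmin _ hmem
      simp [Fin.le_def] at this
      omega
  -- Any linear functional of the greedy filling; used with g = 1 for the size and g = w for the
  -- value.
  have key : ∀ g : Fin n → ℝ,
      ∑ j, g j * (if k < j then x j else if j = k then z - ∑ j ∈ Finset.Ioi k, x j else 0)
        = ∑ j ∈ Finset.Ioi k, g j * x j + g k * (z - ∑ j ∈ Finset.Ioi k, x j) := by
    intro g
    have h1 : ∑ j ∈ Finset.Ioi k, g j * x j = ∑ j, if k < j then g j * x j else 0 := by
      rw [← Finset.sum_filter]
      congr 1
      ext j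
      simp
    have h2 : g k * (z - ∑ j ∈ Finset.Ioi k, x j)
        = ∑ j, if j = k then g k * (z - ∑ j ∈ Finset.Ioi k, x j) else 0 := by simp
    rw [h1]
    conv_rhs => rw [h2]
    rw [← Finset.sum_add_distrib]
    refine Finset.sum_congr rfl fun j _ => ?_
    rcases lt_trichotomy k j with h | h | h
    · simp [h, h.ne']
    · simp [h]
    · simp [h.not_gt, h.ne]
  refine ⟨k, fun j => if k < j then x j else if j = k then z - ∑ j ∈ Finset.Ioi k, x j else 0,
    ?_, ?_, ?_, ?_⟩
  · intro j
    dsimp only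
    split_ifs
    · exact hx0 j
    · linarith
    · exact le_rfl
  · intro j
    dsimp only
    split_ifs with h1 h2
    · exact le_rfl
    · subst h2; linarith
    · exact hx0 j
  · have := key fun _ => 1
    simp only [one_mul] at this
    rw [this]
    ring
  · rw [key w, term]
    simp only [sub_mul, Finset.sum_sub_distrib, ← Finset.mul_sum]
    ring

/-- At a point glued from one above `k` and one below `k`, the term of `k` is the strict minimum. -/
theorem term_add_term_lt {n : ℕ} {w : Fin n → ℝ} (hw : Monotone w) {k k' : Fin n}
    {x₁ x₀ : Fin n → ℝ} (h₁ : x₁ ∈ stdSimplex ℝ (Fin n)) (h₀ : x₀ ∈ stdSimplex ℝ (Fin n))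
    (hs₁ : ∀ j < k, x₁ j = 0) (hs₀ : ∀ j, k < j → x₀ j = 0) (hp₁ : 0 < x₁ k) (hp₀ : 0 < x₀ k)
    (hne : w k' ≠ w k) :
    term w k x₁ 1 + term w k x₀ 0 < term w k' x₁ 1 + term w k' x₀ 0 := by
  rw [term_one_of_support hw h₁ hs₁, term_zero_of_support hs₀]
  -- A smaller w k' leaves a positive part at k against the mass of x₀; a larger one leaves an
  -- excess at k against the mass of x₁.
  rcases lt_or_gt_of_ne hne with h | h
  · have : 0 < term w k' x₀ 0 := by
      rw [term_zero_eq hw]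
      refine Finset.sum_pos' (fun j _ => mul_nonneg (le_max_right _ _) (h₀.1 j))
        ⟨k, Finset.mem_univ _, mul_pos (lt_max_of_lt_left (by linarith)) hp₀⟩
    linarith [sum_le_term_one hw k' h₁]
  · have : 0 < ∑ j, max (w k' - w j) 0 * x₁ j :=
      Finset.sum_pos' (fun j _ => mul_nonneg (le_max_right _ _) (h₁.1 j))
        ⟨k, Finset.mem_univ _, mul_pos (lt_max_of_lt_left (by linarith)) hp₁⟩
    rw [term_one_eq hw k' h₁]
    linarith [term_zero_nonneg hw k' h₀]

/-- The positive-part form sees k only through w k, so positions of equal weight give the same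
bound. -/
theorem term_congr {n : ℕ} {w : Fin n → ℝ} (hw : Monotone w) {k k' : Fin n} (h : w k' = w k)
    (x : Fin n → ℝ) (z : ℝ) : term w k' x z = term w k x z := by
  rw [term_eq_sum_max hw, term_eq_sum_max hw, h]

/-! ### Polyhedra -/

section Polyhedron

variable {E : Type*} [AddCommGroup E] [Module ℝ E]

theorem IsPolyhedron.setOf_forall {ι : Type*} [Finite ι] (a : ι → E →ₗ[ℝ] ℝ) (c : ι → ℝ) :
    IsPolyhedron {v | ∀ k, a k v ≤ c k} := by
  obtain ⟨m, ⟨e⟩⟩ := Finite.exists_equiv_fin ι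
  refine ⟨m, a ∘ e.symm, c ∘ e.symm, ?_⟩
  ext v
  exact e.symm.surjective.forall

/-- All inequalities are pooled into one finite family indexed by a sigma type. -/
theorem IsPolyhedron.iInter {ι : Type*} [Finite ι] {Q : ι → Set E} (h : ∀ i, IsPolyhedron (Q i)) :
    IsPolyhedron (⋂ i, Q i) := by
  choose m a c hQ using h
  have := IsPolyhedron.setOf_forall (fun k : (i : ι) × Fin (m i) => a k.1 k.2)
    (fun k => c k.1 k.2)
  convert this using 1
  ext v
  simp [hQ, Sigma.forall]

theorem IsPolyhedron.inter {Q R : Set E} (hQ : IsPolyhedron Q) (hR : IsPolyhedron R) :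
    IsPolyhedron (Q ∩ R) := by
  rw [Set.inter_eq_iInter]
  exact IsPolyhedron.iInter fun b => by cases b <;> assumption

theorem IsPolyhedron.le (a : E →ₗ[ℝ] ℝ) (c : ℝ) : IsPolyhedron {v | a v ≤ c} := by
  simpa using IsPolyhedron.setOf_forall (fun _ : Unit => a) (fun _ => c)

theorem IsPolyhedron.ge (a : E →ₗ[ℝ] ℝ) (c : ℝ) : IsPolyhedron {v | c ≤ a v} := by
  convert IsPolyhedron.le (-a) (-c) using 1
  ext v
  simp

end Polyhedron

/-! ### The formulation is ideal -/

section Formulation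

variable {τ : ℕ} {p : Fin τ → ℕ} {w : Point p} {b : ℝ}

/-- The linear form `(x, y, z) ↦ x i j`. -/
def coordForm (p : Fin τ → ℕ) (i : Fin τ) (j : Fin (p i)) : (Point p × ℝ × ℝ) →ₗ[ℝ] ℝ :=
  (LinearMap.proj j ∘ₗ LinearMap.proj i) ∘ₗ LinearMap.fst ℝ (Point p) (ℝ × ℝ)

/-- The linear form `(x, y, z) ↦ y`. -/
def outputForm (p : Fin τ → ℕ) : (Point p × ℝ × ℝ) →ₗ[ℝ] ℝ :=
  LinearMap.fst ℝ ℝ ℝ ∘ₗ LinearMap.snd ℝ (Point p) (ℝ × ℝ)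

/-- The linear form `(x, y, z) ↦ z`. -/
def binaryForm (p : Fin τ → ℕ) : (Point p × ℝ × ℝ) →ₗ[ℝ] ℝ :=
  LinearMap.snd ℝ ℝ ℝ ∘ₗ LinearMap.snd ℝ (Point p) (ℝ × ℝ)

@[simp] theorem coordForm_apply (i : Fin τ) (j : Fin (p i)) (v : Point p × ℝ × ℝ) :
    coordForm p i j v = v.1 i j := rfl

@[simp] theorem outputForm_apply (v : Point p × ℝ × ℝ) : outputForm p v = v.2.1 := rfl

@[simp] theorem binaryForm_apply (v : Point p × ℝ × ℝ) : binaryForm p v = v.2.2 := rfl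

theorem isPolyhedron_halfspace (w : Point p) (b : ℝ) (J : (i : Fin τ) → Fin (p i)) :
    IsPolyhedron (halfspace w b J) := by
  have h := IsPolyhedron.le (outputForm p - ((∑ i, (w i (J i) • binaryForm p
    + ∑ j ∈ Finset.Ioi (J i), (w i j - w i (J i)) • coordForm p i j)) + b • binaryForm p)) 0
  convert h using 1
  ext v
  simp [halfspace, upperBound]

theorem isPolyhedron_relaxation (w : Point p) (b : ℝ) (F : Set ((i : Fin τ) → Fin (p i))) :
    IsPolyhedron (relaxation w b F) := by
  have h₁ := IsPolyhedron.le ((∑ i, ∑ j, w i j • coordForm p i j) - outputForm p) (-b)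
  have h₂ := IsPolyhedron.iInter fun J : F => isPolyhedron_halfspace w b J.1
  have h₃ := IsPolyhedron.iInter fun i : Fin τ =>
    (IsPolyhedron.iInter fun j : Fin (p i) => IsPolyhedron.ge (coordForm p i j) 0).inter
      ((IsPolyhedron.ge (∑ j, coordForm p i j) 1).inter
        (IsPolyhedron.le (∑ j, coordForm p i j) 1))
  have h₄ := IsPolyhedron.ge (outputForm p) 0
  have h₅ := (IsPolyhedron.ge (binaryForm p) 0).inter (IsPolyhedron.le (binaryForm p) 1)
  convert h₁.inter (h₂.inter (h₃.inter (h₄.inter h₅))) using 1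
  ext v
  have e₁ : affine w b v.1 ≤ v.2.1 ↔ ∑ i, ∑ j, w i j * v.1 i j - v.2.1 ≤ -b := by
    unfold affine
    constructor <;> intro h <;> linarith
  simp only [relaxation, simplexProduct, stdSimplex, Set.mem_ofPred_eq, Set.mem_inter_iff,
    Set.mem_iInter, e₁, Set.mem_Icc, LinearMap.sub_apply, LinearMap.sum_apply,
    LinearMap.smul_apply, smul_eq_mul, coordForm_apply, outputForm_apply, binaryForm_apply,
    Subtype.forall, le_antisymm_iff (b := (1 : ℝ))]
  constructor
  · rintro ⟨h1, h2, h3, h4, h5⟩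
    exact ⟨h1, h2, fun i => ⟨(h3 i).1, (h3 i).2.2, (h3 i).2.1⟩, h4, h5⟩
  · rintro ⟨h1, h2, h3, h4, h5⟩
    exact ⟨h1, h2, fun i => ⟨(h3 i).1, (h3 i).2.2, (h3 i).2.1⟩, h4, h5⟩

theorem upperBound_zero_nonneg (hw : ∀ i, Monotone (w i)) (J : (i : Fin τ) → Fin (p i))
    {x : Point p} (hx : x ∈ simplexProduct p) : 0 ≤ upperBound w b J x 0 := by
  rw [upperBound_eq_sum_term, mul_zero, add_zero]
  exact Finset.sum_nonneg fun i _ => term_zero_nonneg (hw i) (J i) (hx i)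

theorem affine_le_upperBound_one (hw : ∀ i, Monotone (w i)) (J : (i : Fin τ) → Fin (p i))
    {x : Point p} (hx : x ∈ simplexProduct p) : affine w b x ≤ upperBound w b J x 1 := by
  rw [upperBound_eq_sum_term, mul_one, affine]
  gcongr with i
  exact sum_le_term_one (hw i) (J i) (hx i)

theorem upperBound_zero_of_support {J : (i : Fin τ) → Fin (p i)} {x : Point p}
    (hs : ∀ i j, J i < j → x i j = 0) : upperBound w b J x 0 = 0 := by
  rw [upperBound_eq_sum_term, mul_zero, add_zero]
  exact Finset.sum_eq_zero fun i _ => term_zero_of_support (hs i)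

theorem upperBound_one_of_support (hw : ∀ i, Monotone (w i)) {J : (i : Fin τ) → Fin (p i)}
    {x : Point p} (hx : x ∈ simplexProduct p) (hs : ∀ i, ∀ j < J i, x i j = 0) :
    upperBound w b J x 1 = affine w b x := by
  rw [upperBound_eq_sum_term, mul_one, affine]
  congr 1
  exact Finset.sum_congr rfl fun i _ => term_one_of_support (hw i) (hx i) (hs i)

theorem upperBound_convexComb (J : (i : Fin τ) → Fin (p i)) (x₁ x₀ : Point p) (s : ℝ) :
    upperBound w b J (s • x₁ + (1 - s) • x₀) s
      = s * upperBound w b J x₁ 1 + (1 - s) * upperBound w b J x₀ 0 := by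
  have h : ∀ i, term (w i) (J i) ((s • x₁ + (1 - s) • x₀) i) s
      = s * term (w i) (J i) (x₁ i) 1 + (1 - s) * term (w i) (J i) (x₀ i) 0 :=
    fun i => term_convexComb (w i) (J i) (x₁ i) (x₀ i) s
  simp only [upperBound_eq_sum_term, h, Finset.sum_add_distrib, ← Finset.mul_sum]
  ring

theorem affine_convexComb (x₁ x₀ : Point p) (s : ℝ) :
    affine w b (s • x₁ + (1 - s) • x₀) = s * affine w b x₁ + (1 - s) * affine w b x₀ := by
  have h : ∀ i j, w i j * (s • x₁ + (1 - s) • x₀) i j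
      = s * (w i j * x₁ i j) + (1 - s) * (w i j * x₀ i j) := by
    intro i j
    simp only [Pi.add_apply, Pi.smul_apply, smul_eq_mul]
    ring
  simp only [affine, h, Finset.sum_add_distrib, ← Finset.mul_sum]
  ring

theorem convex_simplexProduct : Convex ℝ (simplexProduct p) := by
  intro x hx y hy s t hs ht hst i
  exact convex_stdSimplex ℝ _ (hx i) (hy i) hs ht hst

theorem mem_relaxation_zero (hw : ∀ i, Monotone (w i)) {x : Point p} (hx : x ∈ simplexProduct p)
    (hf : affine w b x ≤ 0) (F : Set ((i : Fin τ) → Fin (p i))) :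
    (x, (0 : ℝ), (0 : ℝ)) ∈ relaxation w b F :=
  ⟨hf, fun J _ => upperBound_zero_nonneg hw J hx, hx, le_rfl, le_rfl, zero_le_one⟩

theorem mem_relaxation_one (hw : ∀ i, Monotone (w i)) {x : Point p} (hx : x ∈ simplexProduct p)
    (hf : 0 ≤ affine w b x) (F : Set ((i : Fin τ) → Fin (p i))) :
    (x, affine w b x, (1 : ℝ)) ∈ relaxation w b F :=
  ⟨le_rfl, fun J _ => affine_le_upperBound_one hw J hx, hx, hf, zero_le_one, le_rfl⟩

theorem isMIPFormulation (hp : ∀ i, 0 < p i) (hw : ∀ i, Monotone (w i)) :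
    IsMIPFormulation (relaxation w b Set.univ)
      ((simplexProduct p).graphOn (relu ∘ affine w b)) := by
  refine ⟨isPolyhedron_relaxation w b _, ?_⟩
  ext ⟨x, y⟩
  simp only [Set.mem_graphOn, Set.mem_ofPred_eq, Function.comp, relu]
  constructor
  · rintro ⟨hx, rfl⟩
    rcases le_total (affine w b x) 0 with h | h
    · exact ⟨0, Or.inl rfl, by rw [max_eq_left h]; exact mem_relaxation_zero hw hx h _⟩
    · exact ⟨1, Or.inr rfl, by rw [max_eq_right h]; exact mem_relaxation_one hw hx h _⟩
  · rintro ⟨z, rfl | rfl, h1, h2, hx, h0, -⟩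
    · refine ⟨hx, ?_⟩
      -- Nothing lies above the last positions, so at z = 0 this choice of J bounds y by 0.
      have hy : y ≤ upperBound w b (fun i => ⟨p i - 1, Nat.sub_lt (hp i) one_pos⟩) x 0 :=
        h2 _ (Set.mem_univ _)
      rw [upperBound_zero_of_support fun i j hj => by
        have := j.2
        rw [Fin.lt_def] at hj
        simp only at hj
        omega] at hy
      have hy0 : y = 0 := le_antisymm hy h0
      simp only at h1
      rw [max_eq_left (h1.trans hy), hy0]
    · refine ⟨hx, ?_⟩
      -- Nothing lies below the first positions, so at z = 1 this choice of J bounds y by f(x).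
      have hy : y ≤ upperBound w b (fun i => ⟨0, hp i⟩) x 1 := h2 _ (Set.mem_univ _)
      rw [upperBound_one_of_support hw hx fun i j hj => absurd hj (by simp [Fin.lt_def])] at hy
      have hy1 : y = affine w b x := le_antisymm hy h1
      rw [max_eq_right (hy1 ▸ h0), hy1]

/-- Every point of the relaxation with fractional `z` lies between a point with `z = 1` and a point
with `z = 0`. -/
theorem exists_split (hp : ∀ i, 0 < p i) {x : Point p} {y z : ℝ}
    (hv : (x, y, z) ∈ relaxation w b Set.univ) (h0 : 0 < z) (h1 : z < 1) :
    ∃ x₁ ∈ simplexProduct p, ∃ x₀ ∈ simplexProduct p,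
      x = z • x₁ + (1 - z) • x₀ ∧ y = z * affine w b x₁ := by
  obtain ⟨hf, hJ, hx, hy, hz⟩ := hv
  simp only at hf hJ hx hy hz
  choose K u hu0 hux hus huw using fun i => exists_fill (hp i) (w i) (hx i) hz
  have hyu : y ≤ (∑ i, ∑ j, w i j * u i j) + b * z := by
    have : y ≤ upperBound w b K x z := hJ K (Set.mem_univ _)
    rwa [upperBound_eq_sum_term, ← Finset.sum_congr rfl fun i _ => huw i] at this
  -- Both lower bounds on y are needed: y ≥ 0 if f(x) ≤ 0, and y ≥ f(x) otherwise.
  have hyx : z * affine w b x ≤ y := by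
    rcases le_total (affine w b x) 0 with h | h
    · exact (mul_nonpos_of_nonneg_of_nonpos h0.le h).trans hy
    · exact (mul_le_of_le_one_left h h1.le).trans hf
  obtain ⟨s, t, hs, ht, hst, hsty⟩ :
      y ∈ segment ℝ (z * affine w b x) ((∑ i, ∑ j, w i j * u i j) + b * z) := by
    rw [segment_eq_Icc (hyx.trans hyu)]
    exact ⟨hyx, hyu⟩
  have hs' : s = 1 - t := by linarith
  subst hs'
  have ht1 : t ≤ 1 := by linarith
  -- The same weights that place y between the two values interpolate between the fillings z x and
  -- u.
  let v : Point p := fun i j => (1 - t) * (z * x i j) + t * u i j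
  have hv0 : ∀ i j, 0 ≤ v i j := fun i j =>
    add_nonneg (mul_nonneg hs (mul_nonneg h0.le ((hx i).1 j))) (mul_nonneg ht (hu0 i j))
  have hvx : ∀ i j, v i j ≤ x i j := fun i j => by
    have a := mul_le_mul_of_nonneg_left (mul_le_of_le_one_left ((hx i).1 j) h1.le) hs
    have c := mul_le_mul_of_nonneg_left (hux i j) ht
    simp only [v]
    linarith
  have hvs : ∀ i, ∑ j, v i j = z := fun i => by
    simp only [v, Finset.sum_add_distrib, ← Finset.mul_sum, hus, (hx i).2]
    ring
  have hvy : (∑ i, ∑ j, w i j * v i j) + b * z = y := by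
    have : ∀ i j, w i j * v i j = (1 - t) * (z * (w i j * x i j)) + t * (w i j * u i j) :=
      fun i j => by simp only [v]; ring
    simp only [this, Finset.sum_add_distrib, ← Finset.mul_sum]
    rw [← hsty, affine]
    simp only [smul_eq_mul]
    ring
  have hz1 : 0 < 1 - z := by linarith
  refine ⟨z⁻¹ • v, fun i => ⟨fun j => ?_, ?_⟩, (1 - z)⁻¹ • (x - v), fun i => ⟨fun j => ?_, ?_⟩,
    ?_, ?_⟩
  · exact mul_nonneg (inv_nonneg.2 h0.le) (hv0 i j)
  · simp only [Pi.smul_apply, smul_eq_mul, ← Finset.mul_sum, hvs]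
    exact inv_mul_cancel₀ h0.ne'
  · exact mul_nonneg (inv_nonneg.2 hz1.le) (sub_nonneg.2 (hvx i j))
  · simp only [Pi.smul_apply, Pi.sub_apply, smul_eq_mul, ← Finset.mul_sum, Finset.sum_sub_distrib,
      hvs, (hx i).2]
    exact inv_mul_cancel₀ hz1.ne'
  · rw [smul_inv_smul₀ h0.ne', smul_inv_smul₀ hz1.ne', add_sub_cancel]
  · have : ∀ i j, w i j * (z⁻¹ • v) i j = z⁻¹ * (w i j * v i j) := fun i j => by
      simp only [Pi.smul_apply, smul_eq_mul]
      ring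
    simp only [affine, this, ← Finset.mul_sum]
    rw [mul_add, mul_inv_cancel_left₀ h0.ne', mul_comm z b, hvy]

theorem isIdealFormulation (hp : ∀ i, 0 < p i) (hw : ∀ i, Monotone (w i)) :
    IsIdealFormulation (relaxation w b Set.univ)
      ((simplexProduct p).graphOn (relu ∘ affine w b)) := by
  refine ⟨isMIPFormulation hp hw, ?_⟩
  rintro ⟨x, y, z⟩ ⟨hv, hext⟩
  by_contra! hz
  have h0 : 0 < z := lt_of_le_of_ne hv.2.2.2.2.1 (Ne.symm hz.1)
  have h1 : z < 1 := lt_of_le_of_ne hv.2.2.2.2.2 hz.2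
  obtain ⟨x₁, hx₁, x₀, hx₀, rfl, rfl⟩ := exists_split hp hv h0 h1
  obtain ⟨hf, -, -, hy, -⟩ := hv
  simp only [affine_convexComb] at hf hy
  have hf₁ : 0 ≤ affine w b x₁ := nonneg_of_mul_nonneg_right hy h0
  have hf₀ : affine w b x₀ ≤ 0 := by
    have : (1 - z) * affine w b x₀ ≤ 0 := by linarith
    exact nonpos_of_mul_nonpos_right this (by linarith)
  have := hext (mem_relaxation_one hw hx₁ hf₁ _) (mem_relaxation_zero hw hx₀ hf₀ _)
    ⟨z, 1 - z, h0, by linarith, by ring, by simp⟩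
  exact hz.2 (by simpa using (congrArg (fun v => v.2.2) this).symm)

/-! ### No upper bound is redundant -/

theorem upperBound_congr (hw : ∀ i, Monotone (w i)) {J J' : (i : Fin τ) → Fin (p i)}
    (h : ∀ i, w i (J' i) = w i (J i)) : upperBound w b J' = upperBound w b J := by
  funext x z
  simp only [upperBound_eq_sum_term, term_congr (hw _) (h _)]

theorem exists_ne_of_mem_otherHalfspaces (hw : ∀ i, Monotone (w i))
    {J J' : (i : Fin τ) → Fin (p i)} (h : J' ∈ otherHalfspaces w b J) :
    ∃ i, w i (J' i) ≠ w i (J i) := by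
  by_contra! hne
  exact h (by simp only [halfspace, upperBound_congr hw hne])

/-- A point above the upper bound of `J` that satisfies the upper bounds with another halfspace. -/
theorem exists_separated (hw : ∀ i, Monotone (w i)) {J : (i : Fin τ) → Fin (p i)}
    {x₁ x₀ : Point p} (h₁ : x₁ ∈ simplexProduct p) (h₀ : x₀ ∈ simplexProduct p)
    (hs₁ : ∀ i, ∀ j < J i, x₁ i j = 0) (hs₀ : ∀ i j, J i < j → x₀ i j = 0)
    -- With s = 1/2 both endpoints get the same weight, so the unweighted inequality
    -- `term_add_term_lt` can be summed and scaled.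
    (hp₁ : ∀ i, 0 < x₁ i (J i)) (hp₀ : ∀ i, 0 < x₀ i (J i)) {s : ℝ} (hs : s = 1 / 2) :
    ∃ y, s * affine w b x₁ < y ∧
      (s • x₁ + (1 - s) • x₀, y, s) ∉ halfspace w b J ∧
      ∀ J' ∈ otherHalfspaces w b J, (s • x₁ + (1 - s) • x₀, y, s) ∈ halfspace w b J' := by
  classical
  have hJ : upperBound w b J (s • x₁ + (1 - s) • x₀) s = s * affine w b x₁ := by
    rw [upperBound_convexComb, upperBound_one_of_support hw h₁ hs₁,
      upperBound_zero_of_support hs₀, mul_zero, add_zero]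
  have hlt : ∀ J' ∈ otherHalfspaces w b J,
      s * affine w b x₁ < upperBound w b J' (s • x₁ + (1 - s) • x₀) s := by
    intro J' hJ'
    rw [← hJ, upperBound_convexComb, upperBound_convexComb]
    obtain ⟨i, hi⟩ := exists_ne_of_mem_otherHalfspaces hw hJ'
    have hsum : ∑ i, (term (w i) (J i) (x₁ i) 1 + term (w i) (J i) (x₀ i) 0)
        < ∑ i, (term (w i) (J' i) (x₁ i) 1 + term (w i) (J' i) (x₀ i) 0) := by
      refine Finset.sum_lt_sum (fun i _ => ?_) ⟨i, Finset.mem_univ _,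
        term_add_term_lt (hw i) (h₁ i) (h₀ i) (hs₁ i) (hs₀ i) (hp₁ i) (hp₀ i) hi⟩
      by_cases hi : w i (J' i) = w i (J i)
      · rw [term_congr (hw i) hi, term_congr (hw i) hi]
      · exact (term_add_term_lt (hw i) (h₁ i) (h₀ i) (hs₁ i) (hs₀ i) (hp₁ i) (hp₀ i) hi).le
    simp only [Finset.sum_add_distrib] at hsum
    simp only [upperBound_eq_sum_term, hs]
    linarith
  obtain ⟨y, hy, hy'⟩ : ∃ y, s * affine w b x₁ < y ∧ ∀ J' ∈ otherHalfspaces w b J,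
      y ≤ upperBound w b J' (s • x₁ + (1 - s) • x₀) s := by
    rcases (otherHalfspaces w b J).eq_empty_or_nonempty with he | hne
    -- If every mapping has the halfspace of J, no upper bound remains and any larger y will do.
    · exact ⟨_, lt_add_one _, by simp [he]⟩
    · obtain ⟨J₀, hJ₀, hmin⟩ := Set.exists_min_image (otherHalfspaces w b J)
        (fun J' => upperBound w b J' (s • x₁ + (1 - s) • x₀) s) (Set.toFinite _) hne
      exact ⟨_, hlt J₀ hJ₀, hmin⟩
  exact ⟨y, hy, by simpa [halfspace, hJ] using hy, hy'⟩

theorem vertex_mem_simplexProduct (J : (i : Fin τ) → Fin (p i)) :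
    (fun i => Pi.single (J i) 1 : Point p) ∈ simplexProduct p :=
  fun i => single_mem_stdSimplex ℝ (J i)

theorem affine_vertex (J : (i : Fin τ) → Fin (p i)) :
    affine w b (fun i => Pi.single (J i) 1 : Point p) = (∑ i, w i (J i)) + b := by
  simp [affine, Pi.single_apply]

/-- There is no lower bound on y to respect here, so the vertex of J can serve as both x₁ and x₀. -/
theorem upperRegion_ssubset (hw : ∀ i, Monotone (w i)) (J : (i : Fin τ) → Fin (p i)) :
    upperRegion w b Set.univ ⊂ upperRegion w b (otherHalfspaces w b J) := by
  refine ⟨fun v hv => ⟨hv.1, hv.2.1, fun J' _ => hv.2.2 J' (Set.mem_univ _)⟩, fun hsub => ?_⟩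
  have hJ := vertex_mem_simplexProduct J
  obtain ⟨y, -, hn, ho⟩ := exists_separated (b := b) hw hJ hJ
    (fun i j hj => Pi.single_eq_of_ne hj.ne _) (fun i j hj => Pi.single_eq_of_ne hj.ne' _)
    (fun i => by simp) (fun i => by simp) rfl
  refine hn ((hsub ⟨convex_simplexProduct hJ hJ ?_ ?_ ?_, ?_, ho⟩).2.2 J (Set.mem_univ _)) <;>
    norm_num

/-- A small amount of `d` can be mixed into `c` without changing its strict sign. -/
theorem exists_mixture {c : ℝ} (hc : c ≠ 0) (d : ℝ) :
    ∃ s : ℝ, 0 < s ∧ s < 1 ∧ 0 < c * (s * d + (1 - s) * c) := by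
  have hcont : Continuous fun s : ℝ => c * (s * d + (1 - s) * c) := by fun_prop
  have h0 : 0 < c * ((0 : ℝ) * d + (1 - 0) * c) := by simpa using mul_self_pos.2 hc
  have hev := (hcont.tendsto 0).eventually (lt_mem_nhds h0)
  have hev' : ∀ᶠ s in nhdsWithin (0 : ℝ) (Set.Ioi 0), 0 < c * (s * d + (1 - s) * c) :=
    hev.filter_mono nhdsWithin_le_nhds
  obtain ⟨s, hs, hs'⟩ := (hev'.and (Ioo_mem_nhdsGT one_pos)).exists
  exact ⟨s, hs'.1, hs'.2, hs⟩

theorem affine_le_affine_top (hp : ∀ i, 0 < p i) (hw : ∀ i, Monotone (w i)) {x : Point p}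
    (hx : x ∈ simplexProduct p) :
    affine w b x ≤
      affine w b (fun i => Pi.single ⟨p i - 1, Nat.sub_lt (hp i) one_pos⟩ 1 : Point p) := by
  rw [affine_vertex, affine]
  gcongr with i
  calc ∑ j, w i j * x i j ≤ ∑ j, w i ⟨p i - 1, Nat.sub_lt (hp i) one_pos⟩ * x i j :=
        Finset.sum_le_sum fun j _ => mul_le_mul_of_nonneg_right
          (hw i (by rw [Fin.le_def]; have := j.2; simp only; omega)) ((hx i).1 j)
    _ = _ := by rw [← Finset.mul_sum, (hx i).2, mul_one]

theorem affine_bot_le_affine (hp : ∀ i, 0 < p i) (hw : ∀ i, Monotone (w i)) {x : Point p}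
    (hx : x ∈ simplexProduct p) :
    affine w b (fun i => Pi.single ⟨0, hp i⟩ 1 : Point p) ≤ affine w b x := by
  rw [affine_vertex, affine]
  gcongr with i
  calc w i ⟨0, hp i⟩ = ∑ j, w i ⟨0, hp i⟩ * x i j := by
        rw [← Finset.mul_sum, (hx i).2, mul_one]
    _ ≤ ∑ j, w i j * x i j :=
        Finset.sum_le_sum fun j _ => mul_le_mul_of_nonneg_right
          (hw i (by simp [Fin.le_def])) ((hx i).1 j)

/-- The raised point must also satisfy y ≥ 0 and y ≥ f(x), which follows from y > f(x₁) / 2 once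
f(x₁) ≥ 0 ≥ f(x₀). Irreducibility makes f positive at the top vertex and negative at the bottom one;
mixing in a little of the vertex of J keeps these signs and puts mass at J. -/
theorem relaxation_ssubset (hp : ∀ i, 0 < p i) (hw : ∀ i, Monotone (w i))
    (hirr : IsIrreducible w b) (J : (i : Fin τ) → Fin (p i)) :
    relaxation w b Set.univ ⊂ relaxation w b (otherHalfspaces w b J) := by
  refine ⟨fun v hv => ⟨hv.1, fun J' _ => hv.2.1 J' (Set.mem_univ _), hv.2.2⟩, fun hsub => ?_⟩
  obtain ⟨⟨xp, hxp, hfp⟩, ⟨xn, hxn, hfn⟩⟩ := hirr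
  let e : ((i : Fin τ) → Fin (p i)) → Point p := fun K i => Pi.single (K i) 1
  let top : (i : Fin τ) → Fin (p i) := fun i => ⟨p i - 1, Nat.sub_lt (hp i) one_pos⟩
  let bot : (i : Fin τ) → Fin (p i) := fun i => ⟨0, hp i⟩
  have he : ∀ K, e K ∈ simplexProduct p := vertex_mem_simplexProduct
  have htop : 0 < affine w b (e top) := hfp.trans_le (affine_le_affine_top hp hw hxp)
  have hbot : affine w b (e bot) < 0 := (affine_bot_le_affine hp hw hxn).trans_lt hfn
  obtain ⟨s₁, hs₁, hs₁', hpos⟩ := exists_mixture htop.ne' (affine w b (e J))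
  obtain ⟨s₀, hs₀, hs₀', hneg⟩ := exists_mixture hbot.ne (affine w b (e J))
  rw [← affine_convexComb] at hpos hneg
  have hmass : ∀ K (s : ℝ), 0 < s → s < 1 → ∀ i, 0 < (s • e J + (1 - s) • e K) i (J i) := by
    intro K s h h' i
    have h1 : e J i (J i) = 1 := by simp [e]
    have h2 : 0 ≤ e K i (J i) := (he K i).1 _
    simp only [Pi.add_apply, Pi.smul_apply, smul_eq_mul, h1, mul_one]
    exact add_pos_of_pos_of_nonneg h (mul_nonneg (by linarith) h2)
  have hsupp : ∀ K (s : ℝ) i j, j ≠ J i → j ≠ K i → (s • e J + (1 - s) • e K) i j = 0 := by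
    intro K s i j h h'
    simp [e, h, h']
  have hmem : ∀ K (s : ℝ), 0 < s → s < 1 → s • e J + (1 - s) • e K ∈ simplexProduct p :=
    fun K s h h' => convex_simplexProduct (he J) (he K) h.le (by linarith) (by ring)
  have hpos' := pos_of_mul_pos_right hpos htop.le
  have hneg' : affine w b (s₀ • e J + (1 - s₀) • e bot) < 0 := by
    by_contra! h
    exact absurd (mul_nonpos_of_nonpos_of_nonneg hbot.le h) (not_le.2 hneg)
  obtain ⟨y, hy, hn, ho⟩ := exists_separated (b := b) (J := J) hw (hmem top s₁ hs₁ hs₁')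
    (hmem bot s₀ hs₀ hs₀')
    (fun i j hj => hsupp _ _ i j hj.ne fun h => by
      have := (J i).2
      rw [h, Fin.lt_def] at hj
      simp only [top] at hj
      omega)
    (fun i j hj => hsupp _ _ i j hj.ne' fun h => by
      rw [h, Fin.lt_def] at hj
      simp [bot] at hj)
    (hmass _ _ hs₁ hs₁') (hmass _ _ hs₀ hs₀') rfl
  refine hn ((hsub ⟨?_, ho, convex_simplexProduct (hmem top s₁ hs₁ hs₁') (hmem bot s₀ hs₀ hs₀')
    ?_ ?_ ?_, ?_, ?_⟩).2.1 J (Set.mem_univ _))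
  · simp only [affine_convexComb (s := (1 / 2 : ℝ))]
    linarith
  · norm_num
  · norm_num
  · norm_num
  · simp only
    linarith
  · norm_num

end Formulation

/-! ### Running programs with a bound on the number of steps -/

/-- Started in `s`, the program `P` halts after at most `N` steps in a store that satisfies `Q`. -/
def Runs (P : Prog) (s : Store) (N : ℕ) (Q : Store → Prop) : Prop :=
  ∃ n s', Exec P s n s' ∧ n ≤ N ∧ Q s'

/-- Some instructions, followed by a program. -/
def Prog.before (l : List Instr) (P : Prog) : Prog :=
  l.foldr (fun c R => .seq (.instr c) R) P

theorem Runs.mono {P : Prog} {s : Store} {N M : ℕ} {Q R : Store → Prop} (h : Runs P s N Q)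
    (hNM : N ≤ M) (hQR : ∀ s', Q s' → R s') : Runs P s M R := by
  obtain ⟨n, s', he, hn, hQ⟩ := h
  exact ⟨n, s', he, hn.trans hNM, hQR s' hQ⟩

theorem Runs.instr {c : Instr} {s : Store} {Q : Store → Prop} (h : Q (c.run s)) :
    Runs (.instr c) s 1 Q :=
  ⟨1, _, .instr c s, le_rfl, h⟩

theorem Runs.seq {P R : Prog} {s : Store} {N M : ℕ} {Q S : Store → Prop} (hP : Runs P s N Q)
    (hR : ∀ s', Q s' → Runs R s' M S) : Runs (.seq P R) s (N + M) S := by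
  obtain ⟨n, s', he, hn, hQ⟩ := hP
  obtain ⟨m, s'', he', hm, hS⟩ := hR s' hQ
  exact ⟨n + m, s'', .seq he he', add_le_add hn hm, hS⟩

/-- Straight-line code costs its length, and its final store is a fold that `simp` can evaluate. -/
theorem Runs.before {l : List Instr} {P : Prog} {s : Store} {N : ℕ} {Q : Store → Prop}
    (h : Runs P (l.foldl (fun s c => c.run s) s) N Q) :
    Runs (.before l P) s (l.length + N) Q := by
  induction l generalizing s with
  | nil => exact h.mono (by simp) fun _ => id
  | cons c l ih =>
    exact (Runs.seq (Q := fun s' => s' = c.run s) (Runs.instr rfl)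
      (by rintro _ rfl; exact ih h)).mono (by simp; omega) fun _ => id

theorem Runs.cond {t : Test} {P R : Prog} {s : Store} {N : ℕ} {Q : Store → Prop}
    (hP : t.Holds s → Runs P s N Q) (hR : ¬ t.Holds s → Runs R s N Q) :
    Runs (.cond t P R) s (N + 1) Q := by
  by_cases ht : t.Holds s
  · obtain ⟨n, s', he, hn, hQ⟩ := hP ht
    exact ⟨n + 1, s', .cond_true ht he, by omega, hQ⟩
  · obtain ⟨n, s', he, hn, hQ⟩ := hR ht
    exact ⟨n + 1, s', .cond_false ht he, by omega, hQ⟩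

/-- A loop that is run through `N` times, where `inv k` holds after `k` rounds. -/
theorem Runs.loop {t : Test} {P : Prog} (N : ℕ) (cost : ℕ → ℕ) (inv : ℕ → Store → Prop)
    (hstep : ∀ k < N, ∀ s, inv k s → t.Holds s ∧ Runs P s (cost k) (inv (k + 1)))
    (hend : ∀ s, inv N s → ¬ t.Holds s) {s : Store} (h0 : inv 0 s) :
    Runs (.loop t P) s (∑ k ∈ Finset.range N, (cost k + 1) + 1) (inv N) := by
  induction N generalizing cost inv s with
  | zero => exact ⟨1, s, .loop_false (hend s h0), by simp, h0⟩
  | succ N ih =>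
    obtain ⟨ht, n, s', he, hn, hs'⟩ := hstep 0 (by omega) s h0
    -- After the first round, the remaining ones form a loop with shifted invariant and costs.
    obtain ⟨m, s'', he', hm, hs''⟩ := ih (fun k => cost (k + 1)) (fun k => inv (k + 1))
      (fun k hk => hstep (k + 1) (by omega)) hend hs'
    refine ⟨n + m + 1, s'', .loop_true ht he he', ?_, hs''⟩
    rw [Finset.sum_range_succ']
    omega

/-! ### The separation program -/

/-- One round of the scan through a simplex: position `nreg 3 + nreg 5 - 1` of the arrays is read,
the value of the term of this position is compared with the smallest value so far. -/
def scanBody : Prog :=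
  -- Natural registers 8 and 9 hold 1 and 0, and real register 10 holds 0, so adding 9 or 10 copies
  -- a register. The suffix sums in real registers 4 and 5 are updated only after the comparison,
  -- since the term needs the strict tail.
  .before [.nsub 5 5 8, .nadd 6 3 5, .rload 7 0 6, .rload 8 1 6, .rsub 9 2 4, .rmul 9 7 9,
      .radd 9 9 5]
    (.seq (.cond (.rlt 9 6) (.before [.radd 6 9 10] (.instr (.nadd 7 5 9)))
        (.instr (.nadd 6 6 9)))
      (.before [.radd 4 4 8, .rmul 7 7 8] (.instr (.radd 5 5 7))))

/-- The treatment of one simplex. -/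
def simplexBody : Prog :=
  -- The best value starts as that of the last position, w z, because its strict tail is empty.
  .before [.nload 4 0 2, .nadd 5 4 9, .rconst 4 0, .rconst 5 0, .nsub 7 4 8, .nadd 6 3 7,
      .rload 7 0 6, .rmul 6 7 2]
    (.seq (.loop (.nlt 9 5) scanBody)
      (.before [.nstore 1 2 7, .radd 3 3 6, .nadd 3 3 4] (.instr (.nadd 2 2 8))))

/-- The separation program. -/
def separationProg : Prog :=
  -- The total starts at b z, so after the loop it is the smallest right-hand side, to be compared
  -- with y.
  .before [.nconst 8 1, .rmul 3 0 2]
    (.seq (.loop (.nlt 2 0) simplexBody)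
      (.cond (.rlt 3 1) (.instr (.nconst 1 1)) (.instr (.nconst 1 0))))

/-- The value of the term of position `k` in a block of length `q` at offset `o`, for the weights
`a` and the point `x`. -/
noncomputable def scanValue (a x : ℕ → ℝ) (z : ℝ) (o q k : ℕ) : ℝ :=
  a (o + k) * (z - ∑ j ∈ Finset.Ico (k + 1) q, x (o + j))
    + ∑ j ∈ Finset.Ico (k + 1) q, a (o + j) * x (o + j)

/-- What the two loops never change. -/
structure Frame (τ : ℕ) (sizes : ℕ → ℕ) (a x : ℕ → ℝ) (y z : ℝ) (s : Store) : Prop where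
  count : s.nreg 0 = τ
  one : s.nreg 8 = 1
  zero : s.nreg 9 = 0
  output : s.rreg 1 = y
  binary : s.rreg 2 = z
  rzero : s.rreg 10 = 0
  sizes : s.narr 0 = sizes
  weights : s.rarr 0 = a
  point : s.rarr 1 = x

/-- The invariant of the scan: the positions from `c` on have been treated. -/
structure ScanInv (a x : ℕ → ℝ) (z : ℝ) (i o q : ℕ) (total : ℝ) (K : ℕ → ℕ) (c : ℕ)
    (s : Store) : Prop where
  index : s.nreg 2 = i
  offset : s.nreg 3 = o
  size : s.nreg 4 = q
  todo : s.nreg 5 = c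
  total : s.rreg 3 = total
  choices : s.narr 1 = K
  mass : s.rreg 4 = ∑ j ∈ Finset.Ico c q, x (o + j)
  value : s.rreg 5 = ∑ j ∈ Finset.Ico c q, a (o + j) * x (o + j)
  best_lt : s.nreg 7 < q
  best_eq : s.rreg 6 = scanValue a x z o q (s.nreg 7)
  best_le : ∀ k, c ≤ k → k < q → s.rreg 6 ≤ scanValue a x z o q k

section Scan

variable {τ : ℕ} {sizes : ℕ → ℕ} {a x : ℕ → ℝ} {y z : ℝ} {i o q : ℕ} {total : ℝ} {K : ℕ → ℕ}

theorem runs_scanBody {c : ℕ} (hc : c < q) {s : Store} (hF : Frame τ sizes a x y z s)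
    (hI : ScanInv a x z i o q total K (c + 1) s) :
    Runs scanBody s 13 fun s' => Frame τ sizes a x y z s' ∧ ScanInv a x z i o q total K c s' := by
  obtain ⟨f1, f2, f3, f4, f5, f6, f7, f8, f9⟩ := hF
  obtain ⟨i1, i2, i3, i4, i5, i6, i7, i8, i9, i10, i11⟩ := hI
  have hval : a (o + c) * (z - s.rreg 4) + s.rreg 5 = scanValue a x z o q c := by
    rw [i7, i8, scanValue]
  have hmass : s.rreg 4 + x (o + c) = ∑ j ∈ Finset.Ico c q, x (o + j) := by
    rw [i7, Finset.sum_eq_sum_Ico_succ_bot hc, add_comm]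
  have hvalue : s.rreg 5 + a (o + c) * x (o + c)
      = ∑ j ∈ Finset.Ico c q, a (o + j) * x (o + j) := by
    rw [i8, Finset.sum_eq_sum_Ico_succ_bot hc, add_comm]
  -- Both branches meet in this condition: the minimum already covers position c, the suffix sums do
  -- not yet.
  refine Runs.before (N := 6) (Runs.seq (N := 3) (M := 3) (Q := fun s' =>
    Frame τ sizes a x y z s' ∧ s'.nreg 2 = i ∧ s'.nreg 3 = o ∧ s'.nreg 4 = q ∧ s'.nreg 5 = c ∧
    s'.rreg 3 = total ∧ s'.narr 1 = K ∧ s'.rreg 4 = s.rreg 4 ∧ s'.rreg 5 = s.rreg 5 ∧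
    s'.rreg 7 = a (o + c) ∧ s'.rreg 8 = x (o + c) ∧ s'.nreg 7 < q ∧
    s'.rreg 6 = scanValue a x z o q (s'.nreg 7) ∧
    ∀ k, c ≤ k → k < q → s'.rreg 6 ≤ scanValue a x z o q k)
    (Runs.cond (N := 2) (fun ht => Runs.before (N := 1) (Runs.instr ?_))
      fun ht => (Runs.instr ?_).mono (by norm_num) fun _ => id) ?_)
  · simp [Test.Holds, Instr.run, f2, f5, f8, f9, i2, i4, hval] at ht
    refine ⟨?_, ?_⟩
    · constructor <;> simp [Instr.run, *]
    · simp [Instr.run, f2, f3, f5, f6, f8, f9, i1, i2, i3, i4, i5, i6, hval, hc]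
      intro k hk hkq
      rcases hk.eq_or_lt with rfl | hk
      · rfl
      · exact ht.le.trans (i11 k hk hkq)
  · simp [Test.Holds, Instr.run, f2, f5, f8, f9, i2, i4, hval] at ht
    refine ⟨?_, ?_⟩
    · constructor <;> simp [Instr.run, *]
    · simp [Instr.run, f2, f5, f8, f9, i1, i2, i3, i4, i5, i6, i9]
      refine ⟨i10, fun k hk hkq => ?_⟩
      rcases hk.eq_or_lt with rfl | hk
      · exact ht
      · exact i11 k hk hkq
  · rintro s' ⟨⟨g1, g2, g3, g4, g5, g6, g7, g8, g9⟩, j1, j2, j3, j4, j5, j6, j7, j8, j9, j10, j11,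
      j12, j13⟩
    refine Runs.before (N := 1) (Runs.instr ⟨?_, ?_⟩)
    · constructor <;> simp [Instr.run, *]
    · constructor <;>
        simp [Instr.run, j1, j2, j3, j4, j5, j6, j7, j8, j9, j10, hmass,
          hvalue]
      · exact j11
      · exact j12
      · exact j13

theorem runs_scan {s : Store} (hF : Frame τ sizes a x y z s)
    (hI : ScanInv a x z i o q total K q s) :
    Runs (.loop (.nlt 9 5) scanBody) s (14 * q + 1) fun s' =>
      Frame τ sizes a x y z s' ∧ ScanInv a x z i o q total K 0 s' := by
  refine (Runs.loop q (fun _ => 13)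
    -- The scan runs downwards: after k rounds the positions below q - k remain.
    (fun k s => Frame τ sizes a x y z s ∧ ScanInv a x z i o q total K (q - k) s)
    (fun k hk s hs => ⟨?_, ?_⟩) (fun s hs => ?_) ⟨hF, hI⟩).mono ?_ ?_
  · simp only [Test.Holds, hs.1.zero, hs.2.todo]
    omega
  · have : q - k = q - (k + 1) + 1 := by omega
    exact runs_scanBody (by omega) hs.1 (this ▸ hs.2)
  · simp [Test.Holds, hs.1.zero, hs.2.todo]
  · simp
    omega
  · intro s' hs'
    simpa using hs'

theorem runs_simplexBody {s : Store} (hF : Frame τ sizes a x y z s) (hi : s.nreg 2 = i)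
    (ho : s.nreg 3 = o) (hq : sizes i = q) (hq0 : 0 < q) (ht : s.rreg 3 = total) :
    Runs simplexBody s (14 * q + 13) fun s' => Frame τ sizes a x y z s' ∧ s'.nreg 2 = i + 1 ∧
      s'.nreg 3 = o + q ∧ ∃ k < q, s'.narr 1 = Function.update (s.narr 1) i k ∧
        s'.rreg 3 = total + scanValue a x z o q k ∧
        ∀ k' < q, scanValue a x z o q k ≤ scanValue a x z o q k' := by
  refine (Runs.before (N := 14 * q + 1 + 4) (Runs.seq (runs_scan (τ := τ) (sizes := sizes) (a := a)
    (x := x) (y := y) (z := z) (i := i) (o := o) (q := q) (total := total) (K := s.narr 1)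
    ?_ ?_) ?_)).mono (by simp; omega) fun _ => id
  · obtain ⟨f1, f2, f3, f4, f5, f6, f7, f8, f9⟩ := hF
    constructor <;> simp [Instr.run, *]
  · obtain ⟨f1, f2, f3, f4, f5, f6, f7, f8, f9⟩ := hF
    have : q - 1 + 1 = q := by omega
    constructor <;> simp [Instr.run, scanValue, *]
    intro k hk hk'
    omega
  · rintro s' ⟨⟨f1, f2, f3, f4, f5, f6, f7, f8, f9⟩,
      ⟨i1, i2, i3, i4, i5, i6, i7, i8, i9, i10, i11⟩⟩
    refine Runs.before (N := 1) (Runs.instr ⟨?_, ?_, ?_, s'.nreg 7, i9, ?_, ?_, ?_⟩)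
    · constructor <;> simp [Instr.run, *]
    · simp [Instr.run, *]
    · simp [Instr.run, *]
    · simp [Instr.run, i1, i6]
    · simp [Instr.run, i5, i10]
    · exact fun k hk => i10 ▸ i11 k (Nat.zero_le k) hk

end Scan

/-! ### Correctness and running time of the separation program -/

section Separation

variable {τ : ℕ} {p : Fin τ → ℕ}

/-- The position of the first entry of a simplex in the flattened arrays. -/
def blockOffset (p : Fin τ → ℕ) (i : ℕ) : ℕ :=
  ∑ k ∈ Finset.range i, if h : k < τ then p ⟨k, h⟩ else 0

theorem blockOffset_succ (p : Fin τ → ℕ) (i : Fin τ) :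
    blockOffset p (i + 1) = blockOffset p i + p i := by
  simp [blockOffset, Finset.sum_range_succ]

theorem flatten_blockOffset (v : Point p) (i : Fin τ) (j : Fin (p i)) :
    flatten v (blockOffset p i + j) = v i j := by
  have hoff : blockOffset p i + j = (finSigmaFinEquiv ⟨i, j⟩ : Fin (∑ i, p i)) := by
    rw [finSigmaFinEquiv_apply, blockOffset, Finset.sum_range]
    congr 1
    refine Finset.sum_congr rfl fun k _ => ?_
    have : (k : ℕ) < τ := k.2.trans i.2
    simp only [this, dif_pos]
    rfl
  have hlt : blockOffset p i + j < ∑ i, p i := hoff ▸ (finSigmaFinEquiv ⟨i, j⟩).2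
  have hfin : (⟨blockOffset p i + j, hlt⟩ : Fin (∑ i, p i)) = finSigmaFinEquiv ⟨i, j⟩ :=
    Fin.ext hoff
  rw [flatten, dif_pos hlt, hfin, Equiv.symm_apply_apply]

theorem sum_Ico_flatten {q : ℕ} (k : Fin q) (g : ℕ → ℝ) :
    ∑ j ∈ Finset.Ico (k + 1 : ℕ) q, g j = ∑ j ∈ Finset.Ioi k, g j := by
  have h : Finset.Ico (k + 1 : ℕ) q = (Finset.Ioi k).map Fin.valEmbedding := by
    rw [Fin.map_valEmbedding_Ioi]
    rfl
  rw [h, Finset.sum_map]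
  rfl

/-- Collecting the factor w_k in the term leaves only the two suffix sums kept by the scan. -/
theorem scanValue_flatten (w x : Point p) (z : ℝ) (i : Fin τ) (k : Fin (p i)) :
    scanValue (flatten w) (flatten x) z (blockOffset p i) (p i) k = term (w i) k (x i) z := by
  simp only [scanValue, sum_Ico_flatten, flatten_blockOffset, term, sub_mul,
    Finset.sum_sub_distrib, ← Finset.mul_sum]
  ring

/-- The invariant of the loop over the simplices: the first `n` of them have been treated, and `M`
picks a smallest term in each simplex. -/
structure SeparationInv (w : Point p) (b : ℝ) (x : Point p) (y z : ℝ)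
    (M : (i : Fin τ) → Fin (p i)) (n : ℕ) (s : Store) : Prop where
  frame : Frame τ (fun i => if h : i < τ then p ⟨i, h⟩ else 0) (flatten w) (flatten x) y z s
  index : s.nreg 2 = n
  offset : s.nreg 3 = blockOffset p n
  choices : ∀ i : Fin τ, (i : ℕ) < n → ∃ h : s.narr 1 i < p i,
    term (w i) ⟨s.narr 1 i, h⟩ (x i) z = term (w i) (M i) (x i) z
  total : s.rreg 3 = b * z
    + ∑ k ∈ Finset.range n, if h : k < τ then term (w ⟨k, h⟩) (M ⟨k, h⟩) (x ⟨k, h⟩) z else 0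

theorem runs_simplexBody_of_inv (hp : ∀ i, 0 < p i) {w : Point p} {b : ℝ} {x : Point p} {y z : ℝ}
    {M : (i : Fin τ) → Fin (p i)}
    (hM : ∀ i k, term (w i) (M i) (x i) z ≤ term (w i) k (x i) z) (i : Fin τ) {s : Store}
    (hs : SeparationInv w b x y z M i s) :
    Runs simplexBody s (14 * p i + 13) (SeparationInv w b x y z M (i + 1)) := by
  obtain ⟨hF, hi, ho, hc, ht⟩ := hs
  refine (runs_simplexBody (q := p i) hF hi ho (by simp) (hp i) ht).mono le_rfl ?_
  rintro s' ⟨hF', hi', ho', k, hk, hnarr, htot, hmin⟩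
  have hval := scanValue_flatten w x z i ⟨k, hk⟩
  simp only at hval
  -- With ties the scan may pick another minimiser than `M i`, so only the values are compared.
  have hopt : term (w i) ⟨k, hk⟩ (x i) z = term (w i) (M i) (x i) z := by
    refine le_antisymm ?_ (hM i _)
    rw [← hval, ← scanValue_flatten]
    exact hmin _ (M i).2
  refine ⟨hF', hi', by rw [ho', blockOffset_succ], fun i' hi'' => ?_, ?_⟩
  · rcases (Nat.lt_succ_iff.1 hi'').eq_or_lt with h | h
    · obtain rfl : i' = i := Fin.ext h
      have : s'.narr 1 i' = k := by rw [hnarr, Function.update_self]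
      simp only [this]
      exact ⟨hk, hopt⟩
    · have : s'.narr 1 i' = s.narr 1 i' := by rw [hnarr, Function.update_of_ne h.ne]
      simp only [this]
      exact hc i' h
  · rw [htot, hval, hopt, Finset.sum_range_succ, dif_pos i.2, add_assoc]

theorem runs_separationProg (hp : ∀ i, 0 < p i) (w : Point p) (b : ℝ) (x : Point p) (y z : ℝ) :
    Runs separationProg (inputStore p w b x y z) (28 * ((∑ i, p i) + 1)) (Answers w b x y z) := by
  have hne : ∀ i, ∃ k : Fin (p i), ∀ k', term (w i) k (x i) z ≤ term (w i) k' (x i) z := by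
    intro i
    have : Nonempty (Fin (p i)) := ⟨⟨0, hp i⟩⟩
    exact Finite.exists_min fun k => term (w i) k (x i) z
  choose M hM using hne
  have hsum : ∀ g : Fin τ → ℝ,
      ∑ k ∈ Finset.range τ, (if h : k < τ then g ⟨k, h⟩ else 0) = ∑ i, g i := by
    intro g
    rw [Finset.sum_range]
    simp
  have hmin : ∀ J, upperBound w b M x z ≤ upperBound w b J x z := by
    intro J
    simp only [upperBound_eq_sum_term]
    gcongr with i
    exact hM i (J i)
  -- Each simplex costs 14 p_i + 14 including the loop test, and p_i ≥ 1 absorbs the constant.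
  have hcost : ∑ k ∈ Finset.range τ, ((if h : k < τ then 14 * p ⟨k, h⟩ + 13 else 0) + 1)
      ≤ 28 * ∑ i, p i := by
    rw [Finset.sum_range, Finset.mul_sum]
    refine Finset.sum_le_sum fun i _ => ?_
    have := hp i
    simp only [i.2, dif_pos, Fin.eta]
    omega
  refine (Runs.before (N := (∑ k ∈ Finset.range τ,
    ((if h : k < τ then 14 * p ⟨k, h⟩ + 13 else 0) + 1) + 1) + 2) (Runs.seq
    (Runs.loop τ (fun k => if h : k < τ then 14 * p ⟨k, h⟩ + 13 else 0)
      (SeparationInv w b x y z M) (fun k hk s hs => ⟨?_, ?_⟩) (fun s hs => ?_) ?_)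
    fun s hs => ?_)).mono (by simp only [List.length_cons, List.length_nil]; omega) fun _ => id
  · simpa [Test.Holds, hs.index, hs.frame.count] using hk
  · rw [dif_pos hk]
    exact runs_simplexBody_of_inv hp hM ⟨k, hk⟩ hs
  · simp [Test.Holds, hs.index, hs.frame.count]
  · constructor
    · constructor <;> simp [Instr.run, inputStore]
    all_goals simp [Instr.run, inputStore, blockOffset]
  · obtain ⟨hF, -, -, hc, ht⟩ := hs
    have htot : s.rreg 3 = upperBound w b M x z := by
      rw [ht, hsum fun i => term (w i) (M i) (x i) z, upperBound_eq_sum_term, add_comm]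
    refine Runs.cond (N := 1) (fun hlt => Runs.instr (Or.inr ⟨?_, ?_⟩))
      fun hle => Runs.instr (Or.inl ⟨?_, ?_⟩)
    · simp [Instr.run]
    · simp only [Test.Holds, htot, hF.output] at hlt
      choose h hterm using fun i => hc i i.2
      have hJ : upperBound w b (fun i => ⟨s.narr 1 i, h i⟩) x z = upperBound w b M x z := by
        simp only [upperBound_eq_sum_term, hterm]
      refine ⟨fun i => ⟨s.narr 1 i, h i⟩, fun i => rfl, ?_, fun J' => ?_⟩
      · rwa [hJ]
      · rw [hJ]
        exact sub_le_sub_left (hmin J') y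
    · simp [Instr.run]
    · simp only [Test.Holds, htot, hF.output, not_lt] at hle
      exact fun J => hle.trans (hmin J)

end Separation

end OneHotReLU

theorem corollary5 :
    -- the formulation is ideal, and no upper bound of the family is redundant
    (∀ (τ : ℕ) (p : Fin τ → ℕ) (w : OneHotReLU.Point p) (b : ℝ),
      (∀ i, 0 < p i) → (∀ i, Monotone (w i)) →
        OneHotReLU.IsIdealFormulation (OneHotReLU.relaxation w b Set.univ)
          ((OneHotReLU.simplexProduct p).graphOn
            (OneHotReLU.relu ∘ OneHotReLU.affine w b)) ∧
        (∀ J : (i : Fin τ) → Fin (p i),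
          OneHotReLU.upperRegion w b Set.univ ⊂
            OneHotReLU.upperRegion w b (OneHotReLU.otherHalfspaces w b J)) ∧
        (OneHotReLU.IsIrreducible w b → ∀ J : (i : Fin τ) → Fin (p i),
          OneHotReLU.relaxation w b Set.univ ⊂
            OneHotReLU.relaxation w b (OneHotReLU.otherHalfspaces w b J))) ∧
    -- one program finds a most violated upper bound, for all inputs, in linear time
    (∃ (P : OneHotReLU.Prog) (C : ℕ), ∀ (τ : ℕ) (p : Fin τ → ℕ) (w : OneHotReLU.Point p) (b : ℝ),
      (∀ i, 0 < p i) → (∀ i, Monotone (w i)) →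
        ∀ (x : OneHotReLU.Point p) (y z : ℝ), ∃ (n : ℕ) (s : OneHotReLU.Store),
          OneHotReLU.Exec P (OneHotReLU.inputStore p w b x y z) n s ∧
          n ≤ C * ((∑ i, p i) + 1) ∧
          OneHotReLU.Answers w b x y z s) := by
  exact ⟨fun _ _ _ _ hp hw => ⟨OneHotReLU.isIdealFormulation hp hw,
      OneHotReLU.upperRegion_ssubset hw, OneHotReLU.relaxation_ssubset hp hw⟩,
    OneHotReLU.separationProg, 28, fun _ _ w b hp _ x y z =>
      OneHotReLU.runs_separationProg hp w b x y z⟩
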